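/- A real rectangular matrix is called totally non-negative if all of its minors are non-negative (so, in particular, all of its entries are non-negative). Let $F : [0,\infty) \to \mathbb{R}$ be a function, and for a real matrix $A = (a_{ij})$ with non-negative entries let $F[A] := (F(a_{ij}))$ denote the matrix obtained by applying $F$ to each entry. The following are equivalent. 1. For all $m, n$ and every totally non-negative real $m \times n$ matrix $A$, the matrix $F[A]$ is totally non-negative. 2. For all $n$ and every symmetric totally non-negative real $n \times n$ matrix $A$, the matrix $F[A]$ is totally non-negative. 3. There exists a real number $c \geq 0$ such that either $F(x) = c$ for all $x \geq 0$, or $F(x) = c x$ for all $x \geq 0$. -/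

import Mathlib

open scoped NNReal

/-- A real rectangular matrix is totally non-negative if every minor is non-negative.  A minor of
order `k` is the determinant of the submatrix on `k` rows and `k` columns, taken in increasing
order (the empty minor, equal to `1`, is allowed and imposes no condition). -/
def Matrix.IsTotallyNonneg {m n : ℕ} (A : Matrix (Fin m) (Fin n) ℝ) : Prop :=
  ∀ (k : ℕ) (r : Fin k ↪o Fin m) (c : Fin k ↪o Fin n), 0 ≤ (A.submatrix r c).det

/-- The entries of a totally non-negative matrix, being its minors of order one,
are non-negative. -/
theorem Matrix.IsTotallyNonneg.apply_nonneg {m n : ℕ} {A : Matrix (Fin m) (Fin n) ℝ}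
    (hA : A.IsTotallyNonneg) (i : Fin m) (j : Fin n) : 0 ≤ A i j := by
  have h := hA 1 (OrderEmbedding.ofStrictMono (fun _ => i) (Subsingleton.strictMono _))
    (OrderEmbedding.ofStrictMono (fun _ => j) (Subsingleton.strictMono _))
  simpa using h

/-- The matrix `F[A]`: the function `F`, defined on `[0, ∞)`, applied to each entry of a matrix
`A` with non-negative entries. -/
def Matrix.entrywise {m n : ℕ} (F : ℝ≥0 → ℝ) (A : Matrix (Fin m) (Fin n) ℝ)
    (hA : ∀ i j, 0 ≤ A i j) : Matrix (Fin m) (Fin n) ℝ :=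
  Matrix.of fun i j => F ⟨A i j, hA i j⟩

/-! Let `f` preserve total non-negativity of symmetric matrices. Rank-one matrices make `f x / f 1`
multiplicative, and the matrices `!![b, b; b, a]` with `b ≤ a` make `f` monotone. So, unless `f` is
constant, `f x = f 1 * x ^ a` on `(0, ∞)` and `f 0 = 0`. A singular tridiagonal `3 × 3` matrix
gives `2 * f 1 ≤ f 2`, that is `1 ≤ a`.

For `a ≤ 1`, perturb the all-ones matrix by `ε`. A suitable minor of order four of the image is a
positive multiple of the determinant of the `3 × 3` matrix with entries `(1 + ε * M i j) ^ a - 1`,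
where `M` is singular. To leading order in `ε` this determinant is then governed by the second
Taylor coefficient `a * (a - 1) / 2`, times the derivative of `det` at `M` in the direction
`M ⊙ M`. That derivative is negative for the chosen `M`, so `a > 1` is impossible.
-/

open Matrix

/-! ### Power functions -/

theorem eq_mul_of_monotone_of_map_add {h : ℝ → ℝ} (hmono : Monotone h)
    (hadd : ∀ x y, h (x + y) = h x + h y) (t : ℝ) : h t = t * h 1 := by
  let φ : ℝ →+ ℝ := AddMonoidHom.mk' h hadd
  have hφ : Continuous φ :=
    MeasureTheory.Measure.AddMonoidHom.continuous_of_measurable φ hmono.measurable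
  simpa [φ] using map_real_smul φ hφ t 1

theorem exists_eq_rpow_of_monotoneOn_of_map_mul {g : ℝ → ℝ} (hpos : ∀ x, 0 < x → 0 < g x)
    (hmono : MonotoneOn g (Set.Ioi 0))
    (hmul : ∀ x y, 0 < x → 0 < y → g (x * y) = g x * g y) :
    ∃ a : ℝ, ∀ x, 0 < x → g x = x ^ a := by
  have hlogmono : Monotone fun t => Real.log (g (Real.exp t)) := fun s t hst =>
    Real.log_le_log (hpos _ (Real.exp_pos s))
      (hmono (Real.exp_pos s) (Real.exp_pos t) (Real.exp_le_exp.2 hst))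
  have hlin := eq_mul_of_monotone_of_map_add hlogmono fun x y => by
    rw [Real.exp_add, hmul _ _ (Real.exp_pos x) (Real.exp_pos y),
      Real.log_mul (hpos _ (Real.exp_pos x)).ne' (hpos _ (Real.exp_pos y)).ne']
  refine ⟨Real.log (g (Real.exp 1)), fun x hx => ?_⟩
  have hlog := hlin (Real.log x)
  simp only [Real.exp_log hx] at hlog
  rw [Real.rpow_def_of_pos hx, ← hlog, Real.exp_log (hpos x hx)]

theorem one_add_rpow_sub_one (a x : ℝ) :
    (1 + x) ^ a - 1 = x * dslope (fun x : ℝ => (1 + x) ^ a) 0 x := by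
  simpa using (sub_smul_dslope (fun x : ℝ => (1 + x) ^ a) 0 x).symm

theorem dslope_one_add_rpow_zero (a : ℝ) : dslope (fun x : ℝ => (1 + x) ^ a) 0 0 = a := by
  have h : HasDerivAt (fun x : ℝ => (1 + x) ^ a) a 0 := by
    simpa using ((hasDerivAt_id (0 : ℝ)).const_add 1).rpow_const (p := a) (by simp)
  rw [dslope_same, h.deriv]

theorem hasDerivAt_dslope_one_add_rpow (a : ℝ) :
    HasDerivAt (dslope (fun x : ℝ => (1 + x) ^ a) 0) (a * (a - 1) / 2) 0 := by
  have h := (Real.one_add_rpow_hasFPowerSeriesAt_zero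
    (a := a)).has_fpower_series_dslope_fslope.hasDerivAt
  have hcoeff : Ring.choose a 2 = a * (a - 1) / 2 := by
    rw [Ring.choose_eq_smul]
    simp [descPochhammer_succ_left, Polynomial.smeval_mul, Polynomial.smeval_sub, div_eq_inv_mul]
  change HasDerivAt _ ((binomialSeries ℝ a).fslope.coeff 1) 0 at h
  rwa [FormalMultilinearSeries.coeff_fslope, binomialSeries,
    FormalMultilinearSeries.coeff_ofScalars, hcoeff] at h

/-! ### Determinants -/

theorem det_eq_mul_det_sub {n : ℕ} {R : Type*} [CommRing R]
    {A : Matrix (Fin (n + 1)) (Fin (n + 1)) R} {c : R} (hrow : ∀ j, A 0 j = c)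
    (hcol : ∀ i, A i 0 = c) :
    A.det = c * (of fun i j : Fin n => A i.succ j.succ - c).det := by
  have h : A.det = (of (Fin.cons (A 0) fun i j => A i.succ j - c)).det :=
    det_eq_of_forall_row_eq_smul_add_const (Fin.cons 0 1) 0 rfl fun i j => by
      cases i using Fin.cases <;> simp [hrow]
  rw [h, det_succ_column_zero, Fin.sum_univ_succ, Finset.sum_eq_zero fun i _ => by simp [hcol]]
  simp only [of_apply, Fin.cons_zero, hrow, Fin.val_zero, pow_zero, one_mul, add_zero]
  rfl

theorem trace_adjugate_mul_eq_sum_det {n R : Type*} [Fintype n] [DecidableEq n] [CommRing R]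
    (A B : Matrix n n R) :
    (adjugate A * B).trace = ∑ i, (A.updateCol i (B.col i)).det := by
  refine Finset.sum_congr rfl fun i _ => ?_
  rw [← cramer_apply, cramer_eq_adjugate_mulVec]
  rfl

theorem hasDerivAt_det {n 𝕜 : Type*} [Fintype n] [DecidableEq n] [NontriviallyNormedField 𝕜]
    {A : 𝕜 → Matrix n n 𝕜} {A' : Matrix n n 𝕜} {x : 𝕜}
    (hA : ∀ i j, HasDerivAt (fun t => A t i j) (A' i j) x) :
    HasDerivAt (fun t => (A t).det) (adjugate (A x) * A').trace x := by
  have hprod (σ : Equiv.Perm n) (i : n) :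
      (∏ j ∈ Finset.univ.erase i, A x (σ j) j) * A' (σ i) i =
        ∏ j, (A x).updateCol i (A'.col i) (σ j) j := by
    rw [← Finset.prod_erase_mul _ _ (Finset.mem_univ i), updateCol_self]
    congr 1
    exact Finset.prod_congr rfl fun j hj => (updateCol_ne (Finset.ne_of_mem_erase hj)).symm
  have hderiv : HasDerivAt (fun t => (A t).det) (∑ σ : Equiv.Perm n, (σ.sign : 𝕜) *
      ∑ i, (∏ j ∈ Finset.univ.erase i, A x (σ j) j) * A' (σ i) i) x := by
    simp only [det_apply']
    exact .fun_sum fun σ _ => (HasDerivAt.fun_finsetProd fun i _ => hA (σ i) i).const_mul _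
  simp only [hprod, Finset.mul_sum] at hderiv
  rwa [Finset.sum_comm, ← Finset.sum_congr rfl fun i _ => det_apply' _,
    ← trace_adjugate_mul_eq_sum_det] at hderiv

theorem nonneg_of_hasDerivAt_of_nonneg_right {f : ℝ → ℝ} {f' x : ℝ}
    (hf : HasDerivAt f f' x) (hx : f x = 0) (hpos : ∀ t > 0, 0 ≤ f (x + t)) : 0 ≤ f' := by
  refine ge_of_tendsto hf.tendsto_slope_zero_right ?_
  filter_upwards [self_mem_nhdsWithin] with t ht
  rw [hx, sub_zero]
  exact smul_nonneg (inv_nonneg.2 (le_of_lt ht)) (hpos t ht)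

-- The coefficient of `ε ^ card n` in the determinant vanishes because `M` is singular, so the sign
-- of the next one, a derivative of `det` at `φ 0 • M`, is decisive.
theorem trace_adjugate_mul_nonneg_of_det_map_nonneg {n : Type*} [Fintype n] [DecidableEq n]
    {M : Matrix n n ℝ} (hM : M.det = 0) {φ : ℝ → ℝ} {c : ℝ} (hφ : HasDerivAt φ c 0)
    (hdet : ∀ ε : ℝ, 0 < ε → 0 ≤ ((ε • M).map fun x => x * φ x).det) :
    0 ≤ (adjugate (φ 0 • M) * (c • (M ⊙ M))).trace := by
  have hderiv := hasDerivAt_det (A := fun ε => of fun i j => φ (ε * M i j) * M i j)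
    (A' := c • (M ⊙ M)) (x := 0) fun i j => by
      have hφ' : HasDerivAt φ c (0 * M i j) := by rwa [zero_mul]
      have h := (hφ'.comp 0 (hasDerivAt_mul_const (M i j))).mul_const (M i j)
      rwa [mul_assoc] at h
  have hzero : (of fun i j => φ (0 * M i j) * M i j) = φ 0 • M := by
    ext i j
    simp
  have hscale (ε : ℝ) :
      (ε • M).map (fun x => x * φ x) = ε • of fun i j => φ (ε * M i j) * M i j := by
    ext i j
    simp only [map_apply, Matrix.smul_apply, of_apply, smul_eq_mul]
    ring
  rw [hzero] at hderiv
  have hdet0 : (of fun i j => φ (0 * M i j) * M i j).det = 0 := by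
    rw [hzero, det_smul, hM, mul_zero]
  refine nonneg_of_hasDerivAt_of_nonneg_right hderiv hdet0 fun ε hε => ?_
  have h := hdet ε hε
  rw [hscale, det_smul] at h
  rw [zero_add]
  exact nonneg_of_mul_nonneg_right h (by positivity)

theorem transvection_mul_apply {ι ι' R : Type*} [Fintype ι] [DecidableEq ι] [CommRing R]
    (A : Matrix ι ι' R) (i j a : ι) (b : ι') (w : R) :
    (transvection i j w * A) a b = A a b + if a = i then w * A j b else 0 := by
  simp [transvection, Matrix.add_mul, single_mul_eq_updateRow_zero, updateRow_apply]

theorem mul_transvection_transpose_apply {ι ι' R : Type*} [Fintype ι] [DecidableEq ι] [CommRing R]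
    (A : Matrix ι' ι R) (i j b : ι) (a : ι') (w : R) :
    (A * (transvection i j w)ᵀ) a b = A a b + if b = i then w * A a j else 0 := by
  rw [← transpose_apply (A * _), transpose_mul, transpose_transpose, transvection_mul_apply]
  simp only [transpose_apply]

/-! ### Totally non-negative matrices -/

section Closure

variable {m n k p q : ℕ}

namespace Matrix.IsTotallyNonneg

variable {A : Matrix (Fin m) (Fin n) ℝ}

theorem det_submatrix_nonneg (hA : A.IsTotallyNonneg) {r : Fin k → Fin m} {c : Fin k → Fin n}
    (hr : Monotone r) (hc : Monotone c) : 0 ≤ (A.submatrix r c).det := by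
  by_cases hri : Function.Injective r
  · by_cases hci : Function.Injective c
    · exact hA k (OrderEmbedding.ofStrictMono r (hr.strictMono_of_injective hri))
        (OrderEmbedding.ofStrictMono c (hc.strictMono_of_injective hci))
    · obtain ⟨i, j, hij, hne⟩ := Function.not_injective_iff.1 hci
      exact (det_zero_of_column_eq hne fun l => by simp [hij]).ge
  · obtain ⟨i, j, hij, hne⟩ := Function.not_injective_iff.1 hri
    exact (det_zero_of_row_eq hne (by ext l; simp [hij])).ge

theorem det_nonneg {A : Matrix (Fin n) (Fin n) ℝ} (hA : A.IsTotallyNonneg) : 0 ≤ A.det :=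
  hA.det_submatrix_nonneg monotone_id monotone_id

protected theorem submatrix (hA : A.IsTotallyNonneg) {r : Fin p → Fin m} {c : Fin q → Fin n}
    (hr : Monotone r) (hc : Monotone c) : (A.submatrix r c).IsTotallyNonneg := fun _ r' c' => by
  rw [submatrix_submatrix]
  exact hA.det_submatrix_nonneg (hr.comp r'.monotone) (hc.comp c'.monotone)

protected theorem transpose (hA : A.IsTotallyNonneg) : Aᵀ.IsTotallyNonneg := fun k r c => by
  rw [← det_transpose]
  exact hA k c r

protected theorem smul (hA : A.IsTotallyNonneg) {c : ℝ} (hc : 0 ≤ c) :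
    (c • A).IsTotallyNonneg := fun k r s => by
  rw [submatrix_smul, Pi.smul_apply, Pi.smul_apply, det_smul]
  exact mul_nonneg (by positivity) (hA k r s)

-- Monotonicity of `Function.update id i j` says that `i` and `j` are adjacent or equal.
theorem updateRow_add_smul (hA : A.IsTotallyNonneg) {i j : Fin m}
    (hij : Monotone (Function.update id i j)) {w : ℝ} (hw : 0 ≤ w) :
    (A.updateRow i (A i + w • A j)).IsTotallyNonneg := fun k r c => by
  by_cases hi : i ∈ Set.range r
  · obtain ⟨p, rfl⟩ := hi
    have hsum : (A.updateRow (r p) (A (r p) + w • A j)).submatrix r c =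
        (A.submatrix r c).updateRow p (A.submatrix r c p + w • fun q => A j (c q)) := by
      ext a b
      by_cases ha : a = p
      · subst ha; simp
      · simp [updateRow_ne, ha, r.injective.ne ha]
    have hswap : (A.submatrix r c).updateRow p (fun q => A j (c q)) =
        A.submatrix (Function.update id (r p) j ∘ r) c := by
      ext a b
      by_cases ha : a = p
      · subst ha; simp
      · simp [updateRow_ne, ha]
    rw [hsum, det_updateRow_add, det_updateRow_smul, updateRow_eq_self, hswap]
    exact add_nonneg (hA k r c)
      (mul_nonneg hw (hA.det_submatrix_nonneg (hij.comp r.monotone) c.monotone))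
  · have hsame : (A.updateRow i (A i + w • A j)).submatrix r c = A.submatrix r c := by
      ext a b
      rw [submatrix_apply, updateRow_ne fun h => hi ⟨a, h⟩, submatrix_apply]
    rw [hsame]
    exact hA k r c

theorem transvection_mul {i j : Fin m} (hij : Monotone (Function.update id i j)) {w : ℝ}
    (hw : 0 ≤ w) (hA : A.IsTotallyNonneg) : (transvection i j w * A).IsTotallyNonneg := by
  convert hA.updateRow_add_smul hij hw using 1
  ext a b
  by_cases ha : a = i <;> simp [ha]

theorem transvection_congr {A : Matrix (Fin n) (Fin n) ℝ} {i j : Fin n}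
    (hA : A.IsTotallyNonneg) (hij : Monotone (Function.update id i j)) {w : ℝ} (hw : 0 ≤ w) :
    (transvection i j w * A * (transvection i j w)ᵀ).IsTotallyNonneg := by
  simpa [Matrix.mul_assoc] using
    (((hA.transvection_mul hij hw).transpose).transvection_mul hij hw).transpose

end Matrix.IsTotallyNonneg

theorem isTotallyNonneg_vecMulVec {v : Fin m → ℝ} {w : Fin n → ℝ} (hv : ∀ i, 0 ≤ v i)
    (hw : ∀ j, 0 ≤ w j) : (vecMulVec v w).IsTotallyNonneg := fun k r c => by
  match k with
  | 0 => simp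
  | 1 => simpa [vecMulVec_apply] using mul_nonneg (hv _) (hw _)
  | k + 2 => exact (det_vecMulVec (v ∘ r) (w ∘ c)).ge

theorem isTotallyNonneg_const {c : ℝ} (hc : 0 ≤ c) :
    (of fun (_ : Fin m) (_ : Fin n) => c).IsTotallyNonneg := by
  simpa [vecMulVec] using isTotallyNonneg_vecMulVec (m := m) (n := n) (v := fun _ => c) (w := 1)
    (fun _ => hc) fun _ => zero_le_one

theorem isTotallyNonneg_diagonal {d : Fin n → ℝ} (hd : ∀ i, 0 ≤ d i) :
    (diagonal d).IsTotallyNonneg := fun k r c => by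
  by_cases hrc : Set.range c ⊆ Set.range r
  · have hrange : Set.range c = Set.range r := Set.eq_of_subset_of_ncard_le hrc <| by
      rw [Set.ncard_range_of_injective r.injective, Set.ncard_range_of_injective c.injective]
    obtain rfl : c = r :=
      DFunLike.coe_injective (Set.range_injOn_strictMono c.strictMono r.strictMono hrange)
    rw [submatrix_diagonal _ _ c.injective, det_diagonal]
    exact Finset.prod_nonneg fun _ _ => hd _
  · obtain ⟨_, ⟨j, rfl⟩, hj⟩ := Set.not_subset.1 hrc
    have hcol (i : Fin k) : diagonal d (r i) (c j) = 0 := diagonal_apply_ne _ fun h => hj ⟨i, h⟩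
    exact (det_eq_zero_of_column_eq_zero j hcol).ge

end Closure

/-! ### Test matrices -/

theorem isTotallyNonneg_fin_two {a b : ℝ} (hb : 0 ≤ b) (hba : b ≤ a) :
    !![b, b; b, a].IsTotallyNonneg := by
  have hd : ∀ i, 0 ≤ ![b, a - b] i := by simp [Fin.forall_fin_two, hb, hba]
  convert (isTotallyNonneg_diagonal hd).transvection_congr (i := 1) (j := 0) (by decide)
    zero_le_one using 1
  ext i j
  simp only [transvection_mul_apply, mul_transvection_transpose_apply]
  fin_cases i <;> fin_cases j <;> simp

theorem isTotallyNonneg_bordered_tridiagonal {ε : ℝ} (hε : 0 ≤ ε) :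
    !![1, 0, 0, 0; 0, 2 * ε, ε, 0; 0, ε, ε, ε; 0, 0, ε, 2 * ε].IsTotallyNonneg := by
  have hd : ∀ i, 0 ≤ ![1, 2 * ε, 0, 2 * ε] i := by simp [Fin.forall_fin_succ, hε]
  convert ((isTotallyNonneg_diagonal hd).transvection_congr (i := 2) (j := 1) (by decide)
    one_half_pos.le).transvection_congr (i := 2) (j := 3) (by decide) one_half_pos.le using 1
  ext i j
  simp only [transvection_mul_apply, mul_transvection_transpose_apply]
  fin_cases i <;> fin_cases j <;> simp
  ring

theorem isTotallyNonneg_tridiagonal :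
    !![2, 1, 0; 1, 1, 1; 0, 1, (2 : ℝ)].IsTotallyNonneg := by
  convert (isTotallyNonneg_bordered_tridiagonal zero_le_one).submatrix
    (r := ![1, 2, 3]) (c := ![1, 2, 3]) (by decide) (by decide) using 1
  ext i j
  fin_cases i <;> fin_cases j <;> simp

/-- A symmetric totally non-negative perturbation of the all-ones matrix, used to bound the exponent
of a power function preserving total non-negativity. Its minor on rows `0, 1, 2, 3` and columns
`0, 2, 3, 4` vanishes for every `ε`. -/
def onesPerturbation (ε : ℝ) : Matrix (Fin 5) (Fin 5) ℝ :=
  !![1, 1, 1, 1, 1;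
     1, 1 + 2 * ε, 1 + 3 * ε, 1 + 4 * ε, 1 + 4 * ε;
     1, 1 + 3 * ε, 1 + 5 * ε, 1 + 7 * ε, 1 + 8 * ε;
     1, 1 + 4 * ε, 1 + 7 * ε, 1 + 10 * ε, 1 + 12 * ε;
     1, 1 + 4 * ε, 1 + 8 * ε, 1 + 12 * ε, 1 + 16 * ε]

theorem isSymm_onesPerturbation (ε : ℝ) : (onesPerturbation ε).IsSymm :=
  IsSymm.ext fun i j => by fin_cases i <;> fin_cases j <;> rfl

theorem isTotallyNonneg_onesPerturbation {ε : ℝ} (hε : 0 ≤ ε) :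
    (onesPerturbation ε).IsTotallyNonneg := by
  -- Sum rows and columns cumulatively, after repeating the middle row and column of the
  -- tridiagonal block so as to create a singular minor.
  have hcore := (isTotallyNonneg_bordered_tridiagonal hε).submatrix
    (r := ![0, 1, 2, 2, 3]) (c := ![0, 1, 2, 2, 3]) (by decide) (by decide)
  have htop : !![1, 1, 1, 0, 0; 1, 1 + 2 * ε, 1 + 3 * ε, ε, 0;
      1, 1 + 3 * ε, 1 + 5 * ε, 2 * ε, ε; 0, ε, 2 * ε, ε, ε; 0, 0, ε, ε, 2 * ε].IsTotallyNonneg := by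
    convert (hcore.transvection_congr (i := 1) (j := 0) (by decide)
      zero_le_one).transvection_congr (i := 2) (j := 1) (by decide) zero_le_one using 1
    ext i j
    simp only [transvection_mul_apply, mul_transvection_transpose_apply]
    fin_cases i <;> fin_cases j <;> simp <;> ring
  convert (htop.transvection_congr (i := 3) (j := 2) (by decide)
    zero_le_one).transvection_congr (i := 4) (j := 3) (by decide) zero_le_one using 1
  ext i j
  simp only [transvection_mul_apply, mul_transvection_transpose_apply]
  fin_cases i <;> fin_cases j <;> simp [onesPerturbation] <;> ring

/-- The singular matrix in whose direction the minor of `onesPerturbation` on rows `0, 1, 2, 3` and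
columns `0, 2, 3, 4` leaves the all-ones matrix (after dropping its first row and column). -/
def perturbationDirection : Matrix (Fin 3) (Fin 3) ℝ :=
  !![3, 4, 4;
     5, 7, 8;
     7, 10, 12]

theorem perturbationDirection_pos (i j : Fin 3) : 0 < perturbationDirection i j := by
  fin_cases i <;> fin_cases j <;> simp [perturbationDirection]

theorem det_perturbationDirection : perturbationDirection.det = 0 := by
  simp only [perturbationDirection, det_fin_three, of_apply, cons_val]
  norm_num

theorem adjugate_perturbationDirection :
    adjugate perturbationDirection = !![4, -8, 4; -4, 8, -4; 1, -2, 1] := by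
  rw [perturbationDirection, adjugate_fin_three_of]
  norm_num

theorem trace_adjugate_mul_hadamard_perturbationDirection :
    (adjugate perturbationDirection * (perturbationDirection ⊙ perturbationDirection)).trace =
      -8 := by
  rw [adjugate_perturbationDirection]
  simp only [perturbationDirection, trace_fin_three, Matrix.mul_apply, hadamard_apply,
    Fin.sum_univ_three, of_apply, cons_val]
  norm_num

theorem onesPerturbation_submatrix (ε : ℝ) :
    (onesPerturbation ε).submatrix ![1, 2, 3] ![2, 3, 4] =
      (ε • perturbationDirection).map fun x => 1 + x := by
  ext i j
  fin_cases i <;> fin_cases j <;> simp [onesPerturbation, perturbationDirection, mul_comm]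

/-! ### Functions preserving total non-negativity -/

/-- The function `f` preserves total non-negativity of symmetric matrices when applied entrywise.
It is defined on all of `ℝ`, but only its values on `[0, ∞)` matter. -/
def PreservesSymmTotallyNonneg (f : ℝ → ℝ) : Prop :=
  ∀ (n : ℕ) (A : Matrix (Fin n) (Fin n) ℝ), A.IsSymm → A.IsTotallyNonneg →
    (A.map f).IsTotallyNonneg

namespace PreservesSymmTotallyNonneg

variable {f : ℝ → ℝ}

theorem nonneg (hf : PreservesSymmTotallyNonneg f) {x : ℝ} (hx : 0 ≤ x) : 0 ≤ f x :=
  (hf 1 (of fun _ _ => x) (IsSymm.ext fun _ _ => rfl)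
    (isTotallyNonneg_const hx)).apply_nonneg 0 0

theorem monotoneOn (hf : PreservesSymmTotallyNonneg f) : MonotoneOn f (Set.Ici 0) := by
  intro b hb a _ hba
  have hdet := (hf 2 !![b, b; b, a] (IsSymm.ext fun i j => by fin_cases i <;> fin_cases j <;> rfl)
    (isTotallyNonneg_fin_two hb hba)).det_nonneg
  have hdet' : 0 ≤ f b * f a - f b * f b := by simpa [det_fin_two] using hdet
  rcases (hf.nonneg hb).eq_or_lt with h | h
  · exact h ▸ hf.nonneg (le_trans hb hba)
  · exact le_of_mul_le_mul_left (sub_nonneg.1 hdet') h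

theorem apply_mul_apply_le (hf : PreservesSymmTotallyNonneg f) {x y z w : ℝ}
    (hx : 0 ≤ x) (hy : 0 ≤ y) (hz : 0 ≤ z) (hw : 0 ≤ w) :
    f (x * w) * f (y * z) ≤ f (x * z) * f (y * w) := by
  have hv : ∀ i, 0 ≤ ![x, y, z, w] i := by simp [Fin.forall_fin_succ, hx, hy, hz, hw]
  have hminor := (hf 4 _ (IsSymm.ext fun i j => by simp only [vecMulVec_apply, mul_comm])
    (isTotallyNonneg_vecMulVec hv hv)).det_submatrix_nonneg (r := ![0, 1]) (c := ![2, 3])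
    (by decide) (by decide)
  simp only [det_fin_two, submatrix_apply, map_apply, vecMulVec_apply] at hminor
  exact sub_nonneg.1 hminor

theorem map_mul (hf : PreservesSymmTotallyNonneg f) {a b : ℝ} (ha : 0 ≤ a) (hb : 0 ≤ b) :
    f (a * b) * f 1 = f a * f b :=
  le_antisymm (by simpa using hf.apply_mul_apply_le ha zero_le_one zero_le_one hb)
    (by simpa using hf.apply_mul_apply_le ha zero_le_one hb zero_le_one)

theorem eq_zero_of_map_one_eq_zero (hf : PreservesSymmTotallyNonneg f) (h1 : f 1 = 0)
    {x : ℝ} (hx : 0 ≤ x) : f x = 0 :=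
  mul_self_eq_zero.1 (by rw [← hf.map_mul hx hx, h1, mul_zero])

theorem eq_of_map_zero_ne_zero (hf : PreservesSymmTotallyNonneg f) (h0 : f 0 ≠ 0)
    {x : ℝ} (hx : 0 ≤ x) : f x = f 1 :=
  mul_left_cancel₀ h0 (by rw [← hf.map_mul le_rfl hx, zero_mul])

theorem pos (hf : PreservesSymmTotallyNonneg f) (h1 : f 1 ≠ 0) {x : ℝ} (hx : 0 < x) : 0 < f x := by
  refine (hf.nonneg hx.le).lt_of_ne' fun h => h1 ?_
  have hmul := hf.map_mul hx.le (inv_nonneg.2 hx.le)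
  rwa [mul_inv_cancel₀ hx.ne', h, zero_mul, mul_self_eq_zero] at hmul

theorem exists_eq_mul_rpow (hf : PreservesSymmTotallyNonneg f) (h1 : f 1 ≠ 0) :
    ∃ a : ℝ, ∀ x, 0 < x → f x = f 1 * x ^ a := by
  have hpos1 : 0 < f 1 := hf.pos h1 one_pos
  obtain ⟨a, ha⟩ := exists_eq_rpow_of_monotoneOn_of_map_mul (g := fun x => f x / f 1)
    (fun x hx => div_pos (hf.pos h1 hx) hpos1)
    (fun x hx y hy hxy => div_le_div_of_nonneg_right
      (hf.monotoneOn (Set.Ioi_subset_Ici_self hx) (Set.Ioi_subset_Ici_self hy) hxy) hpos1.le)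
    (fun x y hx hy => by
      rw [div_mul_div_comm, ← hf.map_mul hx.le hy.le, mul_div_mul_right _ _ h1])
  exact ⟨a, fun x hx => by rw [← ha x hx, mul_div_cancel₀ _ h1]⟩

theorem two_mul_map_one_le (hf : PreservesSymmTotallyNonneg f) (h0 : f 0 = 0) (h1 : f 1 ≠ 0) :
    2 * f 1 ≤ f 2 := by
  have hdet := (hf 3 !![2, 1, 0; 1, 1, 1; 0, 1, 2]
    (IsSymm.ext fun i j => by fin_cases i <;> fin_cases j <;> rfl)
    isTotallyNonneg_tridiagonal).det_nonneg
  have hpos : 0 < f 1 * f 2 := mul_pos (hf.pos h1 one_pos) (hf.pos h1 two_pos)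
  have hdet' : 0 ≤ f 1 * f 2 * (f 2 - 2 * f 1) := by
    refine hdet.trans_eq ?_
    simp only [det_fin_three, map_apply, of_apply, cons_val, h0]
    ring
  exact sub_nonneg.1 (nonneg_of_mul_nonneg_right hdet' hpos)

theorem one_le_exponent (hf : PreservesSymmTotallyNonneg f) (h0 : f 0 = 0) (h1 : f 1 ≠ 0) {a : ℝ}
    (hfa : ∀ x, 0 < x → f x = f 1 * x ^ a) : 1 ≤ a := by
  have h2 := hf.two_mul_map_one_le h0 h1
  rw [hfa 2 two_pos, mul_comm] at h2
  refine (Real.rpow_le_rpow_left_iff one_lt_two).1 ?_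
  rw [Real.rpow_one]
  exact le_of_mul_le_mul_left h2 (hf.pos h1 one_pos)

theorem det_map_perturbationDirection_nonneg (hf : PreservesSymmTotallyNonneg f) (h1 : f 1 ≠ 0)
    {ε : ℝ} (hε : 0 ≤ ε) :
    0 ≤ ((ε • perturbationDirection).map fun x => f (1 + x) - f 1).det := by
  have hminor := (hf 5 _ (isSymm_onesPerturbation ε)
    (isTotallyNonneg_onesPerturbation hε)).det_submatrix_nonneg
    (r := ![0, 1, 2, 3]) (c := ![0, 2, 3, 4]) (by decide) (by decide)
  have hmap : (of fun i j : Fin 3 => ((onesPerturbation ε).map f).submatrix ![0, 1, 2, 3]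
      ![0, 2, 3, 4] i.succ j.succ - f 1) =
        (ε • perturbationDirection).map fun x => f (1 + x) - f 1 :=
    congrArg (fun A => A.map fun x => f x - f 1) (onesPerturbation_submatrix ε)
  rw [det_eq_mul_det_sub (c := f 1) (fun j => by fin_cases j <;> rfl)
    fun i => by fin_cases i <;> rfl, hmap] at hminor
  exact nonneg_of_mul_nonneg_right hminor (hf.pos h1 one_pos)

theorem exponent_le_one (hf : PreservesSymmTotallyNonneg f) (h1 : f 1 ≠ 0) {a : ℝ}
    (hfa : ∀ x, 0 < x → f x = f 1 * x ^ a) : a ≤ 1 := by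
  let φ : ℝ → ℝ := dslope (fun x => (1 + x) ^ a) 0
  have hdiff (x : ℝ) (hx : 0 < x) : f (1 + x) - f 1 = f 1 * (x * φ x) := by
    rw [hfa _ (by positivity), ← one_add_rpow_sub_one, mul_sub, mul_one]
  have hdet (ε : ℝ) (hε : 0 < ε) :
      0 ≤ ((ε • perturbationDirection).map fun x => x * φ x).det := by
    have hmap : (ε • perturbationDirection).map (fun x => f (1 + x) - f 1) =
        f 1 • (ε • perturbationDirection).map fun x => x * φ x := by
      ext i j
      exact hdiff _ (mul_pos hε (perturbationDirection_pos i j))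
    have h := hf.det_map_perturbationDirection_nonneg h1 hε.le
    rw [hmap, det_smul] at h
    exact nonneg_of_mul_nonneg_right h (pow_pos (hf.pos h1 one_pos) _)
  have htrace := trace_adjugate_mul_nonneg_of_det_map_nonneg det_perturbationDirection
    (hasDerivAt_dslope_one_add_rpow a) hdet
  rw [dslope_one_add_rpow_zero, adjugate_smul, Matrix.smul_mul, Matrix.mul_smul, trace_smul,
    trace_smul, trace_adjugate_mul_hadamard_perturbationDirection, Fintype.card_fin] at htrace
  simp only [smul_eq_mul] at htrace
  by_contra! ha
  nlinarith [mul_pos (pow_pos (zero_lt_one.trans ha) 3) (sub_pos.2 ha)]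

theorem eq_const_or_eq_mul (hf : PreservesSymmTotallyNonneg f) :
    ∃ c : ℝ, 0 ≤ c ∧ ((∀ x, 0 ≤ x → f x = c) ∨ ∀ x, 0 ≤ x → f x = c * x) := by
  refine ⟨f 1, hf.nonneg zero_le_one, ?_⟩
  by_cases h1 : f 1 = 0
  · exact .inl fun x hx => by rw [hf.eq_zero_of_map_one_eq_zero h1 hx, h1]
  by_cases h0 : f 0 = 0
  · obtain ⟨a, hfa⟩ := hf.exists_eq_mul_rpow h1
    obtain rfl : a = 1 := (hf.exponent_le_one h1 hfa).antisymm (hf.one_le_exponent h0 h1 hfa)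
    refine .inr fun x hx => ?_
    rcases hx.eq_or_lt with rfl | hx
    · rw [h0, mul_zero]
    · rw [hfa x hx, Real.rpow_one]
  · exact .inl fun x hx => hf.eq_of_map_zero_ne_zero h0 hx

end PreservesSymmTotallyNonneg

theorem entrywise_eq_map {m n : ℕ} (F : ℝ≥0 → ℝ) (A : Matrix (Fin m) (Fin n) ℝ)
    (hA : ∀ i j, 0 ≤ A i j) : entrywise F A hA = A.map fun x => F x.toNNReal := by
  ext i j
  simp only [entrywise, of_apply, map_apply, Real.toNNReal_of_nonneg (hA i j)]
  rfl

theorem theorem4 (F : ℝ≥0 → ℝ) :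
    [ -- `F` preserves total non-negativity of all rectangular matrices
      ∀ (m n : ℕ) (A : Matrix (Fin m) (Fin n) ℝ) (hA : A.IsTotallyNonneg),
        (Matrix.entrywise F A hA.apply_nonneg).IsTotallyNonneg,
      -- `F` preserves total non-negativity of all symmetric matrices
      ∀ (n : ℕ) (A : Matrix (Fin n) (Fin n) ℝ) (_ : A.IsSymm) (hA : A.IsTotallyNonneg),
        (Matrix.entrywise F A hA.apply_nonneg).IsTotallyNonneg,
      -- `F` is a non-negative constant or a non-negative multiple of the identity
      ∃ c : ℝ, 0 ≤ c ∧ ((∀ x : ℝ≥0, F x = c) ∨ (∀ x : ℝ≥0, F x = c * (x : ℝ)))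
    ].TFAE := by
  tfae_have 1 → 2 := fun h n A _ hA => h n n A hA
  tfae_have 2 → 3 := fun h => by
    have hf : PreservesSymmTotallyNonneg fun x => F x.toNNReal := fun n A hs hA => by
      rw [← entrywise_eq_map F A hA.apply_nonneg]
      exact h n A hs hA
    obtain ⟨c, hc, h⟩ := hf.eq_const_or_eq_mul
    exact ⟨c, hc, h.imp (fun h x => by simpa using h x x.2) fun h x => by simpa using h x x.2⟩
  tfae_have 3 → 1 := by
    rintro ⟨c, hc, h | h⟩ m n A hA
    · convert isTotallyNonneg_const (m := m) (n := n) hc using 1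
      exact ext fun i j => h _
    · convert hA.smul hc using 1
      exact ext fun i j => h _
  tfae_finish
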